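/- Let $\mathbb K$ be an algebraically closed field and let $Q\subset R=\mathbb K[[X_1,\dots,X_n]]$ be a proper radical ideal with $r\ge 2$ minimal primes $P_1,\dots,P_r$, such that every $\mathcal O_i=R/P_i$ has Krull dimension one. Put $I=\{1,\dots,r\}$, let $\mathcal O=R/Q$, let $\mathcal M$ be its maximal ideal, and for $g\in\mathcal O$ let $v(g)=(v_1(g),\dots,v_r(g))\in(\mathbb N\cup\{\infty\})^r$, where $v_i(g)$ is the value of the image of $g$ in $\mathcal O_i$ under the normalized discrete valuation of the integral closure of $\mathcal O_i$ in its field of fractions, with $v_i(0)=\infty$. For $G\subseteq\mathcal M$, a $G$-product is a finite product of powers $g^{a_g}$ with $g\in G$, $a_g\in\mathbb N$. A reduction of a nonzero $g\in\mathcal O$ modulo $G$ is an element $h=g-cp$ with $c\in\mathbb K$ and $p$ a $G$-product such that $v_i(h)\ge v_i(g)$ for all $i\in I$ and $v_k(h)>v_k(g)$ for some $k\in I$ with $v_k(g)\ne\infty$. A nonempty finite set $G\subseteq\mathcal M\setminus\{0\}$ is a Standard Basis for $\mathcal O$ if every nonzero element of $\mathcal O$ has a reduction modulo $G$; it is minimal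 if no $g\in G$ has a reduction modulo $G\setminus\{g\}$. Let $\Gamma=\{v(g): g\in\mathcal O\}$ be the semiring of values, with tropical sum the componentwise minimum and tropical product the componentwise sum. A subset $E\subseteq\Gamma$ is a system of generators of $\Gamma$ if every $\gamma\in\Gamma$ is the componentwise minimum of $s$ finite linear combinations of elements of $E$ with coefficients in $\mathbb N$ (where $0\cdot\infty=0$), for some $1\le s\le r$ depending on $\gamma$. (1) If $G$ and $H$ are Standard Bases for $\mathcal O$ and $H$ is minimal, then $v(H)\subseteq v(G)$. (2) All minimal Standard Bases for $\mathcal O$ have the same set of values. (3) If $G$ is a minimal Standard Basis for $\mathcal O$, then $v(G)$ is the unique minimal system of generators of $\Gamma$: it is a system of generators of $\Gamma$, every system of generators of $\Gamma$ contains it, and it is the only system of generators of $\Gamma$ that is minimal with respect to inclusion. -/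

import Mathlib

/-- The order of an element `b` with respect to the powers of the Jacobson radical of a ring `B`:
the supremum of the `n` with `b ∈ J ^ n`.  If `B` is a discrete valuation ring, then `J` is its
maximal ideal and this is the normalized valuation, with value `∞` at `0`. -/
noncomputable def jacobsonOrder (B : Type*) [CommRing B] (b : B) : ℕ∞ :=
  ⨆ n : ℕ, ⨆ _ : b ∈ (⊥ : Ideal B).jacobson ^ n, (n : ℕ∞)

/-- An algebroid curve with `r` branches in `n`-dimensional space over `K`: a proper radical ideal
of `K[[X₁, …, Xₙ]]`, together with an enumeration without repetition of its minimal primes (the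
branches), each of which has a quotient of Krull dimension one. -/
structure AlgebroidCurve (K : Type*) [Field K] (n r : ℕ) where
  ideal : Ideal (MvPowerSeries (Fin n) K)
  ideal_ne_top : ideal ≠ ⊤
  isRadical : ideal.IsRadical
  branch : Fin r → Ideal (MvPowerSeries (Fin n) K)
  branch_injective : Function.Injective branch
  range_branch : Set.range branch = ideal.minimalPrimes
  ringKrullDim_branch : ∀ i, ringKrullDim (MvPowerSeries (Fin n) K ⧸ branch i) = 1

namespace AlgebroidCurve

variable {K : Type*} [Field K] {n r : ℕ} (C : AlgebroidCurve K n r)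

/-- The local ring `𝒪 = K[[X]] / Q` of the curve. -/
abbrev LocalRing : Type _ := MvPowerSeries (Fin n) K ⧸ C.ideal

/-- The local ring `𝒪ᵢ = K[[X]] / Pᵢ` of the `i`-th branch. -/
abbrev BranchRing (i : Fin r) : Type _ := MvPowerSeries (Fin n) K ⧸ C.branch i

/-- The integral closure of `𝒪ᵢ` in its field of fractions. -/
abbrev BranchClosure (i : Fin r) : Type _ :=
  integralClosure (C.BranchRing i) (FractionRing (C.BranchRing i))

theorem ideal_le_branch (i : Fin r) : C.ideal ≤ C.branch i := by
  have h : C.branch i ∈ C.ideal.minimalPrimes := C.range_branch ▸ Set.mem_range_self i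
  exact h.1.2

instance isLocalRing_localRing : IsLocalRing C.LocalRing :=
  haveI : Nontrivial C.LocalRing := Ideal.Quotient.nontrivial_iff.mpr C.ideal_ne_top
  IsLocalRing.of_surjective' (Ideal.Quotient.mk C.ideal) Ideal.Quotient.mk_surjective

/-- The canonical map `𝒪 → 𝒪ᵢ`. -/
noncomputable def toBranch (i : Fin r) : C.LocalRing →+* C.BranchRing i :=
  Ideal.Quotient.factor (C.ideal_le_branch i)

/-- The value `v(g) = (v₁(g), …, vᵣ(g))`, where `vᵢ(g)` is the value of the image of `g` in `𝒪ᵢ`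
for the normalized valuation of the discrete valuation ring that is the integral closure
of `𝒪ᵢ`. -/
noncomputable def value (g : C.LocalRing) : Fin r → ℕ∞ := fun i =>
  jacobsonOrder (C.BranchClosure i)
    (algebraMap (C.BranchRing i) (C.BranchClosure i) (C.toBranch i g))

/-- The set of values `Γ = {v(g) : g ∈ 𝒪}`.  Its semiring operations are those induced by the
componentwise minimum (tropical sum) and the componentwise sum (tropical product). -/
def valueSet : Set (Fin r → ℕ∞) := Set.range C.value

/-- `p` is a `G`-product: a finite product of powers of elements of `G` with exponents in `ℕ`. -/
def IsProduct (G : Set C.LocalRing) (p : C.LocalRing) : Prop :=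
  ∃ α : C.LocalRing →₀ ℕ, (α.support : Set C.LocalRing) ⊆ G ∧ p = α.prod fun g a => g ^ a

/-- `h` is a `k`-reduction of `g` modulo `G`. -/
def IsReductionAt (G : Set C.LocalRing) (k : Fin r) (g h : C.LocalRing) : Prop :=
  ∃ (c : K) (p : C.LocalRing), C.IsProduct G p ∧ h = g - c • p ∧
    (∀ i, C.value g i ≤ C.value h i) ∧ C.value g k < C.value h k

/-- `h` is a reduction of `g` modulo `G`: a `k`-reduction for some `k` with `v_k(g) ≠ ∞`. -/
def IsReduction (G : Set C.LocalRing) (g h : C.LocalRing) : Prop :=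
  ∃ k : Fin r, C.value g k ≠ ⊤ ∧ C.IsReductionAt G k g h

/-- `G` is a Standard Basis for `𝒪`: a nonempty finite set of nonzero elements of the maximal
ideal such that every nonzero element of `𝒪` has a reduction modulo `G`. -/
structure IsStandardBasis (G : Set C.LocalRing) : Prop where
  finite : G.Finite
  nonempty : G.Nonempty
  mem_maximalIdeal : ∀ g ∈ G, g ∈ IsLocalRing.maximalIdeal C.LocalRing
  ne_zero : ∀ g ∈ G, g ≠ 0
  exists_reduction : ∀ g : C.LocalRing, g ≠ 0 → ∃ h, C.IsReduction G g h

/-- A Standard Basis is minimal if no `g ∈ G` has a reduction modulo `G \ {g}`. -/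
structure IsMinimalStandardBasis (G : Set C.LocalRing) : Prop extends C.IsStandardBasis G where
  not_exists_reduction : ∀ g ∈ G, ¬ ∃ h, C.IsReduction (G \ {g}) g h

/-- `E` is a system of generators of the semiring `Γ`: `E ⊆ Γ`, and every `γ ∈ Γ` is the tropical
sum (minimum) of `s` tropical monomials (linear combinations with coefficients in `ℕ`) in
elements of `E`, for some `s` with `1 ≤ s ≤ r`. -/
def Generates (E : Set (Fin r → ℕ∞)) : Prop :=
  E ⊆ C.valueSet ∧ ∀ γ ∈ C.valueSet, ∃ s : ℕ, 1 ≤ s ∧ s ≤ r ∧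
    ∃ α : Fin s → ((Fin r → ℕ∞) →₀ ℕ), (∀ i, ((α i).support : Set (Fin r → ℕ∞)) ⊆ E) ∧
      γ = ⨅ i, (α i).sum fun e a => a • e

end AlgebroidCurve

/-! Two facts carry the theorem. First (`IsStandardBasis.exists_isProduct`), for a Standard Basis
`G`, any `g` and any branch `i`, some `G`-product `p` has `v(p) ≥ v(g)` and `v_i(p) = v_i(g)`. If
`v_i(g)` is finite, reduce until the `i`-th value jumps; the product used at that step works. The
process stops because the conductor allows large values on the other branches to be replaced by `∞`.
Taking one product for each branch shows that `v(G)` generates `Γ`.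

Second (`IsMinimalStandardBasis.image_value_subset`), let `G` be minimal, `g ∈ G`, and let `E`
generate `Γ`. Some monomial in `E` dominates `v(g)` and equals it at a branch `k` where `v_k(g)` is
finite. Replace each generator `e` in it by a `G`-product `p_e` from the first fact, taken at `k`.
If no `p_e` were a multiple of `g`, their product would reduce `g` modulo `G \ {g}`. If `g ∣ p_e`,
cancelling `v_k(g)` leaves only units and forces `v(g) = e`.

The valuations require that the integral closure of each branch be a finite discrete valuation ring
with residue field `K`; this is obtained by comparison with `K⟦T⟧`. -/

open scoped Polynomial PowerSeries

/-! ### Finiteness and locality from adic completeness. -/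

section Adic

variable {D M : Type*} [CommRing D] [AddCommGroup M] [Module D M] (I : Ideal D)

/-- A finite module over an `I`-adically precomplete ring is `I`-adically precomplete. -/
theorem IsPrecomplete.of_finite [IsPrecomplete I D] [Module.Finite D M] : IsPrecomplete I M := by
  rw [← AdicCompletion.of_surjective_iff]
  intro y
  obtain ⟨x, rfl⟩ := AdicCompletion.ofTensorProduct_surjective_of_finite I M y
  induction x using TensorProduct.induction_on with
  | zero => exact ⟨0, by simp⟩
  | tmul a m =>
    obtain ⟨a, rfl⟩ := AdicCompletion.of_surjective I D a
    refine ⟨a • m, ?_⟩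
    ext n
    simp
    rfl
  | add x y hx hy =>
    obtain ⟨a, ha⟩ := hx
    obtain ⟨b, hb⟩ := hy
    exact ⟨a + b, by rw [map_add, map_add, ha, hb]⟩

/-- Over an `I`-adically precomplete ring, an `I`-adically separated module that is finite
modulo `I` is finite. -/
theorem Module.Finite.of_isHausdorff_of_finite_quotient [IsPrecomplete I D] [IsHausdorff I M]
    [Module.Finite D (M ⧸ (I • ⊤ : Submodule D M))] : Module.Finite D M := by
  obtain ⟨k, f, hf⟩ := Module.Finite.exists_fin' D (M ⧸ (I • ⊤ : Submodule D M))
  -- A lift of generators of `M/IM` is surjective modulo `I`; successive approximation makes it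
  -- surjective.
  obtain ⟨g, hg⟩ := Module.projective_lifting_property (Submodule.mkQ (I • ⊤ : Submodule D M)) f
    (Submodule.mkQ_surjective _)
  have : IsPrecomplete I (Fin k → D) := .of_finite I
  exact Module.Finite.of_surjective g
    (surjective_of_mkQ_comp_surjective (I := I) (by rw [hg]; exact hf))

end Adic

theorem Submodule.mem_span_singleton_smul_top_iff {D M : Type*} [CommRing D] [AddCommGroup M]
    [Module D M] {r : D} {x : M} :
    x ∈ (Ideal.span {r} • ⊤ : Submodule D M) ↔ ∃ y, x = r • y := by
  rw [Submodule.ideal_span_singleton_smul, Submodule.mem_smul_pointwise_iff_exists]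
  simp [eq_comm]

/-- If `A = K + 𝔪` with `𝔪` finitely generated, then `A = W + 𝔪 ^ N` with `W` finitely generated
over `K`. -/
theorem Ideal.FG.exists_fg_sub_mem_pow {K A : Type*} [CommRing K] [CommRing A] [Algebra K A]
    {m : Ideal A} (hm : m.FG) (h : ∀ a : A, ∃ c : K, a - algebraMap K A c ∈ m) (N : ℕ) :
    ∃ W : Submodule K A, W.FG ∧ ∀ a, ∃ w ∈ W, a - w ∈ m ^ N := by
  classical
  induction N with
  | zero => exact ⟨⊥, Submodule.fg_bot, fun a => ⟨0, by simp, by simp⟩⟩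
  | succ N ih =>
    obtain ⟨W, hW, hWa⟩ := ih
    obtain ⟨s, hs⟩ := hm
    -- Expand `a - c` in the generators of `𝔪` and approximate each coefficient by `W` modulo `𝔪 ^
    -- N`.
    refine ⟨1 ⊔ Submodule.span K (s : Set A) * W, ?_, fun a => ?_⟩
    · exact (Submodule.FG.sup ⟨{1}, by simp [Submodule.one_eq_span]⟩
        (Submodule.FG.mul ⟨s, rfl⟩ hW))
    · obtain ⟨c, hc⟩ := h a
      rw [← hs] at hc
      obtain ⟨f, -, hf⟩ := Submodule.mem_span_finset.1 hc
      choose w hw hw' using hWa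
      refine ⟨algebraMap K A c + ∑ x ∈ s, x * w (f x), ?_, ?_⟩
      · refine Submodule.add_mem_sup ?_ ?_
        · rw [Submodule.mem_one]; exact ⟨c, rfl⟩
        · exact Submodule.sum_mem _ fun x hx =>
            Submodule.mul_mem_mul (Submodule.subset_span hx) (hw _)
      · rw [← sub_sub, ← hf, ← Finset.sum_sub_distrib]
        refine Ideal.sum_mem _ fun x hx => ?_
        have : f x • x - x * w (f x) = x * (f x - w (f x)) := by rw [smul_eq_mul]; ring
        rw [this, pow_succ', ← hs]
        exact Ideal.mul_mem_mul (Ideal.subset_span hx) (by rw [hs]; exact hw' _)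

/-- A domain that is adically complete with an Artinian quotient is local, since idempotents of the
quotient lift. -/
theorem IsLocalRing.of_isAdicComplete_of_isArtinianRing_quotient {B : Type*} [CommRing B]
    [IsDomain B] (J : Ideal B) [IsAdicComplete J B] [IsArtinianRing (B ⧸ J)] : IsLocalRing B := by
  have hJ : ∀ P : Ideal B, P.IsMaximal → J ≤ P := fun P hP =>
    (IsAdicComplete.le_jacobson_bot J).trans (sInf_le ⟨bot_le, hP⟩)
  obtain ⟨P, hP⟩ := Ideal.exists_maximal B
  refine IsLocalRing.of_unique_max_ideal ⟨P, hP, fun Q hQ => ?_⟩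
  by_contra hPQ
  obtain ⟨x, hxP, hxQ⟩ : ∃ x ∈ P, x ∉ Q := by
    by_contra! h
    exact hPQ (hP.eq_of_le hQ.ne_top h).symm
  -- The powers of `x` stabilize modulo `J`, which yields an idempotent `e` modulo `J` lying in `P`
  -- but not in `Q`.
  obtain ⟨n, y, hy⟩ := IsArtinian.exists_pow_succ_smul_dvd (Ideal.Quotient.mk J x) (1 : B ⧸ J)
  obtain ⟨y, rfl⟩ := Ideal.Quotient.mk_surjective y
  simp only [smul_eq_mul, mul_one] at hy
  have h1 : ∀ k, Ideal.Quotient.mk J (x ^ n) = Ideal.Quotient.mk J (x ^ (n + k) * y ^ k) := by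
    intro k
    induction k with
    | zero => simp
    | succ k ih =>
      rw [ih]
      simp only [map_mul, map_pow]
      rw [pow_add, ← hy]
      simp only [Nat.succ_eq_add_one]
      ring
  have h2 : Ideal.Quotient.mk J (x ^ (n + 1)) =
      Ideal.Quotient.mk J (x ^ (n + 1) * (x ^ (n + 1) * y ^ (n + 1))) := by
    have := congrArg (Ideal.Quotient.mk J x * ·) (h1 (n + 1))
    simp only [← map_mul] at this
    convert this using 2 <;> ring
  set e := x ^ (n + 1) * y ^ (n + 1)
  have heP : e ∈ P := P.mul_mem_right _ (P.pow_mem_of_mem hxP _ (Nat.succ_pos n))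
  have heQ : e ∉ Q := by
    intro he
    have := hJ Q hQ (Ideal.Quotient.eq.1 h2)
    exact hxQ (hQ.isPrime.mem_of_pow_mem _ ((Q.sub_mem_iff_left (Q.mul_mem_left _ he)).1 this))
  have hee : e * e - e ∈ J := by
    have := congrArg (· * Ideal.Quotient.mk J (y ^ (n + 1))) h2
    simp only [← map_mul] at this
    rw [← Ideal.Quotient.eq, this]
    congr 1
    simp only [e]
    ring
  -- The derivative `2e - 1` is its own inverse modulo `J`, because `(2e - 1)² - 1 = 4(e² - e)`.
  obtain ⟨a, ha, hae⟩ := HenselianRing.is_henselian (I := J) (Polynomial.X ^ 2 - Polynomial.X : B[X])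
    (Polynomial.monic_X_pow_sub (by simp)) e (by simpa [sq] using hee) (by
      refine IsUnit.of_mul_eq_one (Ideal.Quotient.mk J (2 * e - 1)) ?_
      rw [← map_mul, ← map_one (Ideal.Quotient.mk J), Ideal.Quotient.eq]
      convert J.mul_mem_left 4 hee using 1
      simp
      ring)
  have ha' : a * (a - 1) = 0 := by
    have : a ^ 2 - a = 0 := by simpa [Polynomial.IsRoot] using ha
    linear_combination this
  rcases mul_eq_zero.1 ha' with h | h
  · rw [h, zero_sub, neg_mem_iff] at hae
    exact heQ (hJ Q hQ hae)
  · rw [sub_eq_zero.1 h] at hae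
    exact hP.ne_top (P.eq_top_iff_one.2 ((P.sub_mem_iff_left heP).1 (hJ P hP hae)))

/-! ### Normalization of a one-dimensional local domain. -/

section Curve

variable (K : Type*) [Field K] (A B : Type*) [CommRing A]

/-- A one-dimensional Noetherian local domain over `K⟦T⟧` with residue field `K`, in which `T` is a
nonzero nonunit, is finite over `K⟦T⟧`. -/
theorem finite_powerSeries_of_ringKrullDim_eq_one [IsDomain A] [IsLocalRing A]
    [IsNoetherianRing A] [Algebra K A] [Algebra K⟦X⟧ A] [IsScalarTower K K⟦X⟧ A]
    (hdim : ringKrullDim A = 1)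
    (hres : ∀ a : A, ∃ c : K, a - algebraMap K A c ∈ IsLocalRing.maximalIdeal A)
    (ht : algebraMap K⟦X⟧ A .X ∈ IsLocalRing.maximalIdeal A)
    (ht0 : algebraMap K⟦X⟧ A .X ≠ 0) : Module.Finite K⟦X⟧ A := by
  set I : Ideal K⟦X⟧ := Ideal.span {.X}
  have hmap : I.map (algebraMap K⟦X⟧ A) = Ideal.span {algebraMap K⟦X⟧ A .X} := by
    simp [I, Ideal.map_span]
  have : IsHausdorff I A := by
    rw [← IsHausdorff.map_algebraMap_iff (S := A), hmap]
    refine IsHausdorff.of_isDomain _ ?_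
    rw [Ne, Ideal.span_singleton_eq_top]
    exact (IsLocalRing.mem_maximalIdeal _).1 ht
  -- Dimension one gives `𝔪 ^ N ⊆ (T)`, so `A` is spanned modulo `T` by a finitely generated
  -- `K`-space.
  obtain ⟨N, hN⟩ := Ideal.exists_pow_le_of_le_radical_of_fg
    ((ringKrullDim_eq_one_iff_of_isLocalRing_isDomain.1 hdim).2 _ ht0)
    (IsNoetherian.noetherian (IsLocalRing.maximalIdeal A))
  obtain ⟨W, ⟨s, rfl⟩, hWa⟩ := Ideal.FG.exists_fg_sub_mem_pow
    (IsNoetherian.noetherian (IsLocalRing.maximalIdeal A)) hres N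
  have : Module.Finite K⟦X⟧ (A ⧸ (I • ⊤ : Submodule K⟦X⟧ A)) := by
    classical
    refine ⟨⟨s.image (Submodule.mkQ _), ?_⟩⟩
    rw [Finset.coe_image, ← Submodule.map_span, eq_top_iff]
    rintro x -
    obtain ⟨a, rfl⟩ := Submodule.mkQ_surjective _ x
    obtain ⟨w, hw, hwa⟩ := hWa a
    refine ⟨w, Submodule.span_le_restrictScalars K K⟦X⟧ (s : Set A) hw, ?_⟩
    rw [← sub_eq_zero, ← map_sub, ← LinearMap.mem_ker, Submodule.ker_mkQ, ← neg_sub]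
    refine neg_mem (Submodule.mem_span_singleton_smul_top_iff.2 ?_)
    obtain ⟨y, hy⟩ := Ideal.mem_span_singleton'.1 (hN hwa)
    exact ⟨y, by rw [← hy, Algebra.smul_def, mul_comm]⟩
  exact Module.Finite.of_isHausdorff_of_finite_quotient I

variable [CommRing B] [Algebra A B]

theorem algebraMap_mem_of_isMaximal [IsLocalRing A] [Algebra.IsIntegral A B] {a : A}
    (ha : a ∈ IsLocalRing.maximalIdeal A) (P : Ideal B)
    [P.IsMaximal] : algebraMap A B a ∈ P := by
  have := IsLocalRing.eq_maximalIdeal (Ideal.isMaximal_comap_of_isIntegral_of_isMaximal (R := A) P)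
  rw [← this] at ha
  exact ha

variable [Algebra K⟦X⟧ A] [Algebra K⟦X⟧ B] [IsScalarTower K⟦X⟧ A B]

/-- By integrality a nonzero `b` divides a nonzero element of `A`, which by dimension one divides a
power `t ^ N`. If `t ^ (N + 1)` divided `b`, then `t` would be zero or a unit; the first kills `b`,
the second is impossible. -/
theorem isHausdorff_span_X_of_ringKrullDim_eq_one [IsDomain A] [IsLocalRing A] [IsDomain B]
    [Algebra.IsIntegral A B] (hdim : ringKrullDim A = 1)
    (ht : algebraMap K⟦X⟧ A .X ∈ IsLocalRing.maximalIdeal A) :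
    IsHausdorff (Ideal.span {.X} : Ideal K⟦X⟧) B := by
  refine ⟨fun b hb => ?_⟩
  by_contra hb0
  obtain ⟨a, hab, ha0⟩ := Submodule.exists_mem_ne_zero_of_ne_bot
    (Ideal.comap_ne_bot_of_integral_mem hb0 (Ideal.mem_span_singleton_self b)
      (Algebra.IsIntegral.isIntegral (R := A) b))
  obtain ⟨N, hN⟩ := (ringKrullDim_eq_one_iff_of_isLocalRing_isDomain.1 hdim).2 _ ha0 ht
  obtain ⟨a', ha'⟩ := Ideal.mem_span_singleton'.1 hN
  obtain ⟨b', hb'⟩ := Ideal.mem_span_singleton'.1 hab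
  have h1 := hb (N + 1)
  rw [SModEq.zero, Ideal.span_singleton_pow, Submodule.mem_span_singleton_smul_top_iff] at h1
  obtain ⟨y, hy⟩ := h1
  set t := algebraMap K⟦X⟧ B .X
  have htt : algebraMap A B (algebraMap K⟦X⟧ A .X) = t :=
    (IsScalarTower.algebraMap_apply K⟦X⟧ A B _).symm
  rw [Algebra.smul_def, map_pow] at hy
  change b = t ^ (N + 1) * y at hy
  have h2 : t ^ N = t ^ N * (algebraMap A B a' * b' * y * t) := by
    have := congrArg (algebraMap A B) ha'
    rw [map_mul, map_pow, htt, ← hb', hy] at this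
    linear_combination -this
  obtain ⟨P, hP⟩ := Ideal.exists_maximal B
  have htP : t ∈ P := htt ▸ algebraMap_mem_of_isMaximal A B ht P
  rcases eq_or_ne t 0 with h0 | h0
  · rw [h0] at hy
    simp at hy
    exact hb0 hy
  · have h3 : 1 = algebraMap A B a' * b' * y * t :=
      mul_left_cancel₀ (pow_ne_zero N h0) (by rw [mul_one]; exact h2)
    exact hP.ne_top ((Ideal.eq_top_iff_one P).2 (h3 ▸ P.mul_mem_left _ htP))


/-- Multiplication by a common denominator is injective and moves the family into `A`. -/
theorem LinearIndependent.card_le_finrank_of_forall_exists_mul [IsDomain A] [IsDomain B]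
    [FaithfulSMul A B] [Module.Finite K⟦X⟧ A]
    (hfrac : ∀ b : B, ∃ a : A, a ≠ 0 ∧ ∃ a', algebraMap A B a * b = algebraMap A B a')
    {ι : Type*} [Fintype ι] {b : ι → B} (hb : LinearIndependent K⟦X⟧ b) :
    Fintype.card ι ≤ Module.finrank K⟦X⟧ A := by
  classical
  choose d hd n hn using hfrac
  have hinj := FaithfulSMul.algebraMap_injective A B
  let c : A := ∏ i, d (b i)
  have hc : algebraMap A B c ≠ 0 := by
    rw [Ne, map_eq_zero_iff _ hinj]
    exact Finset.prod_ne_zero_iff.2 fun i _ => hd _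
  let a : ι → A := fun i => (∏ j ∈ Finset.univ.erase i, d (b j)) * n (b i)
  have ha : ∀ i, algebraMap A B (a i) = algebraMap A B c * b i := by
    intro i
    simp only [a, c]
    rw [← Finset.prod_erase_mul _ _ (Finset.mem_univ i), map_mul, map_mul, mul_assoc, hn]
  have h1 := hb.map' (LinearMap.mulLeft K⟦X⟧ (algebraMap A B c))
    (LinearMap.ker_eq_bot.2 (mul_right_injective₀ hc))
  have h2 : LinearIndependent K⟦X⟧ a := by
    refine LinearIndependent.of_comp (IsScalarTower.toAlgHom K⟦X⟧ A B).toLinearMap ?_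
    convert! h1 using 1
    ext i
    simp [ha]
  exact h2.fintype_card_le_finrank

/-- Lifts of a `K`-independent family in `B/tB` are independent over `K⟦T⟧`: the coefficients of a
relation are divisible by `T`, and dividing by `T` gives another relation. Hence the rank of `A`
bounds the dimension, before `B` is known to be finite. -/
theorem finite_quotient_span_algebraMap_X [IsDomain A] [IsDomain B] [FaithfulSMul A B]
    [Algebra K B] [IsScalarTower K K⟦X⟧ B] [Module.Finite K⟦X⟧ A]
    (ht0 : algebraMap K⟦X⟧ B PowerSeries.X ≠ 0)
    (hfrac : ∀ b : B, ∃ a : A, a ≠ 0 ∧ ∃ a', algebraMap A B a * b = algebraMap A B a') :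
    Module.Finite K (B ⧸ Ideal.span {algebraMap K⟦X⟧ B PowerSeries.X}) := by
  set J := Ideal.span {algebraMap K⟦X⟧ B PowerSeries.X}
  let π : B →ₗ[K⟦X⟧] B ⧸ J := (Ideal.Quotient.mkₐ K⟦X⟧ J).toLinearMap
  have hπ : Function.Surjective π := Ideal.Quotient.mk_surjective
  have hcoeff : ∀ (g : K⟦X⟧) (y : B ⧸ J), g • y = PowerSeries.constantCoeff g • y := by
    intro g y
    obtain ⟨h, hh⟩ := PowerSeries.X_dvd_iff.2
      (show PowerSeries.constantCoeff (g - PowerSeries.C (PowerSeries.constantCoeff g)) = 0 by simp)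
    have hX : (PowerSeries.X * h : K⟦X⟧) • y = 0 := by
      obtain ⟨y, rfl⟩ := hπ y
      rw [← map_smul, Algebra.smul_def, map_mul (algebraMap K⟦X⟧ B), mul_assoc]
      exact Ideal.Quotient.eq_zero_iff_mem.2
        (J.mul_mem_right _ (Ideal.mem_span_singleton_self _))
    rw [sub_eq_iff_eq_add] at hh
    conv_lhs => rw [hh, add_smul, hX, zero_add]
    rw [← algebraMap_smul K⟦X⟧ (PowerSeries.constantCoeff g) y]
    rfl
  have hrank : Module.rank K (B ⧸ J) ≤ (Module.finrank K⟦X⟧ A : ℕ) := by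
    refine rank_le fun s hs => ?_
    choose b hb using hπ
    rw [← Fintype.card_coe]
    refine LinearIndependent.card_le_finrank_of_forall_exists_mul K A B hfrac
      (b := fun i : s => b i) ?_
    rw [Fintype.linearIndependent_iff] at hs ⊢
    have key : ∀ (n : ℕ) (g : s → K⟦X⟧), ∑ i, g i • b i = 0 → ∀ i, PowerSeries.X ^ n ∣ g i := by
      intro n
      induction n with
      | zero => simp
      | succ n ih =>
        intro g hg
        have h1 : ∀ i, PowerSeries.X ∣ g i := by
          intro i
          rw [PowerSeries.X_dvd_iff]
          refine hs (fun i => PowerSeries.constantCoeff (g i)) ?_ i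
          have := congrArg π hg
          rw [map_sum, map_zero] at this
          rw [← this]
          refine Finset.sum_congr rfl fun j _ => ?_
          rw [map_smul, hb, hcoeff]
        choose g' hg' using h1
        have h2 : ∑ i, g' i • b i = 0 := by
          have : algebraMap K⟦X⟧ B PowerSeries.X * ∑ i, g' i • b i = 0 := by
            rw [← Algebra.smul_def, Finset.smul_sum, ← hg]
            refine Finset.sum_congr rfl fun j _ => ?_
            rw [smul_smul, ← hg']
          exact (mul_eq_zero.1 this).resolve_left ht0
        intro i
        rw [hg', pow_succ']
        exact mul_dvd_mul_left _ (ih g' h2 i)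
    intro g hg i
    ext m
    exact PowerSeries.X_pow_dvd_iff.1 (key (m + 1) g hg i) m (Nat.lt_succ_self m)
  exact Module.rank_lt_aleph0_iff.1 (hrank.trans_lt Cardinal.natCast_lt_aleph0)

end Curve

/-- Let `A` be a one-dimensional Noetherian local domain with algebraically closed residue field
`K` that receives a map from `K⟦T⟧` sending `T` to a nonzero nonunit, and let `B` be its integral
closure. Then `B` is finite over `A` and a discrete valuation ring, `A → B` is local, and `B` has
residue field `K`. -/
theorem isDiscreteValuationRing_and_finite_of_ringKrullDim_eq_one {K A B : Type*} [Field K]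
    [IsAlgClosed K] [CommRing A] [IsDomain A] [IsLocalRing A] [IsNoetherianRing A] [Algebra K A]
    [CommRing B] [IsDomain B] [IsIntegrallyClosed B] [Algebra A B] [Algebra.IsIntegral A B]
    [FaithfulSMul A B] (hdim : ringKrullDim A = 1)
    (hres : ∀ a : A, ∃ c : K, a - algebraMap K A c ∈ IsLocalRing.maximalIdeal A)
    (hfrac : ∀ b : B, ∃ a : A, a ≠ 0 ∧ ∃ a', algebraMap A B a * b = algebraMap A B a')
    (φ : K⟦X⟧ →ₐ[K] A) (ht : φ .X ∈ IsLocalRing.maximalIdeal A) (ht0 : φ .X ≠ 0) :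
    Module.Finite A B ∧ ∃ _ : IsDiscreteValuationRing B,
      (∀ a ∈ IsLocalRing.maximalIdeal A, algebraMap A B a ∈ IsLocalRing.maximalIdeal B) ∧
      ∀ b : B, ∃ c : K, b - algebraMap A B (algebraMap K A c) ∈ IsLocalRing.maximalIdeal B := by
  let : Algebra K⟦X⟧ A := φ.toRingHom.toAlgebra
  let : Algebra K⟦X⟧ B := ((algebraMap A B).comp φ.toRingHom).toAlgebra
  let : Algebra K B := ((algebraMap A B).comp (algebraMap K A)).toAlgebra
  have : IsScalarTower K⟦X⟧ A B := .of_algebraMap_eq fun _ => rfl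
  have : IsScalarTower K A B := .of_algebraMap_eq fun _ => rfl
  have : IsScalarTower K K⟦X⟧ A := .of_algebraMap_eq fun c => (φ.commutes c).symm
  have : IsScalarTower K K⟦X⟧ B := .of_algebraMap_eq fun c =>
    congrArg (algebraMap A B) (φ.commutes c).symm
  -- Finiteness of `A` bounds `B/tB`; with separatedness this makes `B` finite, hence `t`-adically
  -- complete, hence local.
  have hfinA : Module.Finite K⟦X⟧ A := finite_powerSeries_of_ringKrullDim_eq_one K A hdim hres ht ht0
  set t := algebraMap K⟦X⟧ B PowerSeries.X
  have htB0 : t ≠ 0 := by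
    change algebraMap A B (φ .X) ≠ 0
    rwa [Ne, map_eq_zero_iff _ (FaithfulSMul.algebraMap_injective A B)]
  set I : Ideal K⟦X⟧ := Ideal.span {PowerSeries.X}
  set J := Ideal.span {t}
  have hfinJ : Module.Finite K (B ⧸ J) := finite_quotient_span_algebraMap_X K A B htB0 hfrac
  have hmap : I.map (algebraMap K⟦X⟧ B) = J := by
    simp [I, J, Ideal.map_span, t]
  have hhaus : IsHausdorff I B := isHausdorff_span_X_of_ringKrullDim_eq_one K A B hdim ht
  have hfinB : Module.Finite K⟦X⟧ B := by
    have h1 : Module.Finite K⟦X⟧ (B ⧸ J) := Module.Finite.of_restrictScalars_finite K K⟦X⟧ _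
    have h2 : (I • ⊤ : Submodule K⟦X⟧ B) = J.restrictScalars K⟦X⟧ := by
      rw [Ideal.smul_top_eq_map, hmap]
    have h3 : Module.Finite K⟦X⟧ (B ⧸ (I • ⊤ : Submodule K⟦X⟧ B)) := by
      rw [h2]
      exact Module.Finite.equiv (Submodule.Quotient.restrictScalarsEquiv K⟦X⟧ J).symm
    exact Module.Finite.of_isHausdorff_of_finite_quotient I
  have hfinAB : Module.Finite A B := Module.Finite.of_restrictScalars_finite K⟦X⟧ A B
  have hcomplete : IsAdicComplete J B :=
    { toIsHausdorff := by rw [← hmap]; exact IsHausdorff.map_algebraMap_iff.2 hhaus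
      toIsPrecomplete := by
        rw [← hmap]; exact IsPrecomplete.map_algebraMap_iff.2 (IsPrecomplete.of_finite I) }
  have hart : IsArtinianRing (B ⧸ J) := IsArtinianRing.of_finite K _
  have hlocal : IsLocalRing B := .of_isAdicComplete_of_isArtinianRing_quotient J
  have hmem : ∀ a ∈ IsLocalRing.maximalIdeal A, algebraMap A B a ∈ IsLocalRing.maximalIdeal B :=
    fun a ha => algebraMap_mem_of_isMaximal A B ha _
  have hnoeth : IsNoetherianRing B := IsNoetherianRing.of_finite A B
  have hnf : ¬ IsField B := by
    rw [IsLocalRing.isField_iff_maximalIdeal_eq]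
    intro h
    exact htB0 ((Submodule.mem_bot B).1 (h ▸ hmem _ ht))
  have hdimA : Ring.DimensionLEOne A :=
    ⟨fun {p} hp _ => Ring.krullDimLE_one_iff_of_noZeroDivisors.1
      (Ring.krullDimLE_iff.2 hdim.le) p hp inferInstance⟩
  have hdimB : Ring.DimensionLEOne B := .of_isIntegral A B
  have hded : IsDedekindDomain B := {}
  refine ⟨hfinAB, ((IsDiscreteValuationRing.TFAE B hnf).out 0 2).2 hded, hmem, fun b => ?_⟩
  have hJm : J ≤ IsLocalRing.maximalIdeal B := by
    rw [Ideal.span_singleton_le_iff_mem]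
    exact hmem _ ht
  have : Module.Finite K (B ⧸ IsLocalRing.maximalIdeal B) :=
    Module.Finite.of_surjective (Ideal.Quotient.factorₐ K hJm).toLinearMap
      (Ideal.Quotient.factor_surjective hJm)
  obtain ⟨c, hc⟩ := (IsAlgClosed.algebraMap_bijective_of_isIntegral (k := K)
    (K := B ⧸ IsLocalRing.maximalIdeal B)).2 (Ideal.Quotient.mk _ b)
  exact ⟨c, Ideal.Quotient.eq.1 hc.symm⟩

/-! ### The valuation on a branch. -/

/-- In a discrete valuation ring, the order with respect to the Jacobson radical is the normalized
valuation. -/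
theorem jacobsonOrder_eq_addVal (B : Type*) [CommRing B] [IsDomain B] [IsDiscreteValuationRing B]
    (b : B) : jacobsonOrder B b = IsDiscreteValuationRing.addVal B b := by
  obtain ⟨ϖ, hϖ⟩ := IsDiscreteValuationRing.exists_irreducible B
  have hmem : ∀ n : ℕ, b ∈ (⊥ : Ideal B).jacobson ^ n ↔
      (n : ℕ∞) ≤ IsDiscreteValuationRing.addVal B b := by
    intro n
    rw [IsLocalRing.jacobson_eq_maximalIdeal _ bot_ne_top, hϖ.maximalIdeal_eq,
      Ideal.span_singleton_pow, Ideal.mem_span_singleton,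
      ← IsDiscreteValuationRing.addVal_le_iff_dvd, hϖ.addVal_pow]
  simp only [jacobsonOrder, hmem]
  -- The value may be `∞`, so the supremum is approached from below.
  refine le_antisymm (iSup₂_le fun _ h => h) (le_of_forall_lt fun a ha => ?_)
  lift a to ℕ using ha.ne_top
  have h1 : ((a + 1 : ℕ) : ℕ∞) ≤ IsDiscreteValuationRing.addVal B b := by
    push_cast
    exact Order.add_one_le_of_lt ha
  exact lt_of_lt_of_le (by exact_mod_cast Nat.lt_succ_self a)
    (le_iSup₂ (f := fun (n : ℕ) (_ : (n : ℕ∞) ≤ IsDiscreteValuationRing.addVal B b) => (n : ℕ∞))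
      _ h1)

/-- A one-dimensional quotient domain of `K⟦X₁, …, Xₙ⟧` receives a homomorphism from `K⟦T⟧` that
sends `T` to a nonzero nonunit. -/
theorem exists_algHom_powerSeries {K : Type*} [Field K] {n : ℕ}
    (P : Ideal (MvPowerSeries (Fin n) K)) [P.IsPrime]
    (hdim : ringKrullDim (MvPowerSeries (Fin n) K ⧸ P) = 1)
    [IsLocalRing (MvPowerSeries (Fin n) K ⧸ P)] :
    ∃ φ : K⟦X⟧ →ₐ[K] MvPowerSeries (Fin n) K ⧸ P,
      φ .X ∈ IsLocalRing.maximalIdeal (MvPowerSeries (Fin n) K ⧸ P) ∧ φ .X ≠ 0 := by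
  have hm := (IsLocalRing.isField_iff_maximalIdeal_eq).not.1
    (ringKrullDim_eq_one_iff_of_isLocalRing_isDomain.1 hdim).1
  obtain ⟨t, ht, ht0⟩ := Submodule.exists_mem_ne_zero_of_ne_bot hm
  obtain ⟨τ, rfl⟩ := Ideal.Quotient.mk_surjective t
  have hτ : MvPowerSeries.constantCoeff τ = 0 := by
    by_contra h
    have : IsUnit τ := MvPowerSeries.isUnit_iff_constantCoeff.2 (isUnit_iff_ne_zero.2 h)
    exact (IsLocalRing.mem_maximalIdeal _).1 ht (this.map _)
  have hs : PowerSeries.HasSubst τ := PowerSeries.HasSubst.of_constantCoeff_zero hτ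
  refine ⟨(Ideal.Quotient.mkₐ K P).comp (PowerSeries.substAlgHom hs), ?_, ?_⟩ <;>
  · rw [AlgHom.comp_apply, PowerSeries.substAlgHom_X]
    assumption

theorem exists_sub_algebraMap_mem_maximalIdeal {K : Type*} [Field K] {n : ℕ}
    (P : Ideal (MvPowerSeries (Fin n) K)) [IsLocalRing (MvPowerSeries (Fin n) K ⧸ P)]
    (a : MvPowerSeries (Fin n) K ⧸ P) :
    ∃ c : K, a - algebraMap K _ c ∈ IsLocalRing.maximalIdeal (MvPowerSeries (Fin n) K ⧸ P) := by
  obtain ⟨f, rfl⟩ := Ideal.Quotient.mk_surjective a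
  have := IsLocalHom.of_surjective (Ideal.Quotient.mk P) Ideal.Quotient.mk_surjective
  refine ⟨MvPowerSeries.constantCoeff f, ?_⟩
  rw [IsLocalRing.mem_maximalIdeal, mem_nonunits_iff]
  change ¬ IsUnit (Ideal.Quotient.mk P (f - MvPowerSeries.C (MvPowerSeries.constantCoeff f)))
  rw [isUnit_map_iff, MvPowerSeries.isUnit_iff_constantCoeff]
  simp

namespace AlgebroidCurve

variable {K : Type*} [Field K] {n r : ℕ} (C : AlgebroidCurve K n r)

instance isPrime_branch (i : Fin r) : (C.branch i).IsPrime := by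
  have h : C.branch i ∈ C.ideal.minimalPrimes := C.range_branch ▸ Set.mem_range_self i
  exact h.1.1

instance isLocalRing_branchRing (i : Fin r) : IsLocalRing (C.BranchRing i) :=
  IsLocalRing.of_surjective' (Ideal.Quotient.mk (C.branch i)) Ideal.Quotient.mk_surjective

theorem exists_mul_eq_algebraMap (i : Fin r) (b : C.BranchClosure i) :
    ∃ a : C.BranchRing i, a ≠ 0 ∧ ∃ a', algebraMap (C.BranchRing i) (C.BranchClosure i) a * b =
      algebraMap (C.BranchRing i) (C.BranchClosure i) a' := by
  obtain ⟨⟨a', a⟩, h⟩ := IsLocalization.surj (nonZeroDivisors (C.BranchRing i))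
    (b : FractionRing (C.BranchRing i))
  refine ⟨a, nonZeroDivisors.ne_zero a.2, a', ?_⟩
  apply Subtype.ext
  rw [mul_comm]
  exact h

theorem branchClosure_spec [IsAlgClosed K] (i : Fin r) :
    Module.Finite (C.BranchRing i) (C.BranchClosure i) ∧
    ∃ _ : IsDiscreteValuationRing (C.BranchClosure i),
      (∀ a ∈ IsLocalRing.maximalIdeal (C.BranchRing i),
        algebraMap (C.BranchRing i) (C.BranchClosure i) a ∈
          IsLocalRing.maximalIdeal (C.BranchClosure i)) ∧
      ∀ b : C.BranchClosure i, ∃ c : K,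
        b - algebraMap (C.BranchRing i) (C.BranchClosure i) (algebraMap K _ c) ∈
          IsLocalRing.maximalIdeal (C.BranchClosure i) := by
  obtain ⟨φ, h1, h2⟩ := exists_algHom_powerSeries (C.branch i) (C.ringKrullDim_branch i)
  have : IsNoetherianRing (C.BranchRing i) := inferInstance
  have hic : IsIntegrallyClosed (C.BranchClosure i) :=
    integralClosure.isIntegrallyClosedOfFiniteExtension (FractionRing (C.BranchRing i))
  refine isDiscreteValuationRing_and_finite_of_ringKrullDim_eq_one (C.ringKrullDim_branch i)
    (exists_sub_algebraMap_mem_maximalIdeal (C.branch i)) (C.exists_mul_eq_algebraMap i) φ h1 h2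

end AlgebroidCurve

/-- A finite extension `B` of `A` inside its fraction field has a nonzero conductor. -/
theorem exists_ne_zero_forall_exists_mul_eq_algebraMap {A B : Type*} [CommRing A] [IsDomain A]
    [CommRing B] [Algebra A B] [Module.Finite A B]
    (h : ∀ b : B, ∃ a : A, a ≠ 0 ∧ ∃ a', algebraMap A B a * b = algebraMap A B a') :
    ∃ a : A, a ≠ 0 ∧ ∀ b : B, ∃ a', algebraMap A B a * b = algebraMap A B a' := by
  classical
  obtain ⟨s, hs⟩ := Module.Finite.fg_top (R := A) (M := B)
  choose d hd n hn using h
  refine ⟨∏ x ∈ s, d x, Finset.prod_ne_zero_iff.2 fun x _ => hd x, fun b => ?_⟩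
  have hb : b ∈ Submodule.span A (s : Set B) := hs ▸ Submodule.mem_top
  induction hb using Submodule.span_induction with
  | mem x hx =>
    exact ⟨(∏ y ∈ s.erase x, d y) * n x, by
      rw [← Finset.prod_erase_mul _ _ hx, map_mul, map_mul, mul_assoc, hn]⟩
  | zero => exact ⟨0, by simp⟩
  | add x y _ _ hx hy =>
    obtain ⟨a, ha⟩ := hx
    obtain ⟨a', ha'⟩ := hy
    exact ⟨a + a', by rw [mul_add, ha, ha', map_add]⟩
  | smul c x _ hx =>
    obtain ⟨a, ha⟩ := hx
    exact ⟨c * a, by rw [mul_smul_comm, ha, map_mul, Algebra.smul_def]⟩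

/-! ### Values and the conductor. -/

namespace AlgebroidCurve

variable {K : Type*} [Field K] {n r : ℕ} (C : AlgebroidCurve K n r)

theorem toBranch_smul (i : Fin r) (c : K) (g : C.LocalRing) :
    C.toBranch i (c • g) = algebraMap K _ c * C.toBranch i g := by
  obtain ⟨f, rfl⟩ := Ideal.Quotient.mk_surjective g
  change Ideal.Quotient.mk (C.branch i) (c • f) = _
  rw [MvPowerSeries.smul_eq_C_mul, map_mul]
  rfl

-- The radical ideal `Q` is the intersection of its minimal primes.
variable {C} in
theorem eq_zero_of_forall_toBranch_eq_zero {g : C.LocalRing} (h : ∀ i, C.toBranch i g = 0) :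
    g = 0 := by
  obtain ⟨f, rfl⟩ := Ideal.Quotient.mk_surjective g
  have h' : ∀ i, f ∈ C.branch i := fun i => Ideal.Quotient.eq_zero_iff_mem.1 (h i)
  rw [Ideal.Quotient.eq_zero_iff_mem, ← C.isRadical.radical, ← Ideal.sInf_minimalPrimes,
    ← C.range_branch, Ideal.mem_sInf]
  rintro _ ⟨i, rfl⟩
  exact h' i

/-- There is an element that vanishes on all branches but one. -/
theorem exists_toBranch_ne_zero (i : Fin r) :
    ∃ w : C.LocalRing, C.toBranch i w ≠ 0 ∧ ∀ j ≠ i, C.toBranch j w = 0 := by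
  classical
  -- A prime containing a finite intersection contains one of its members, against minimality of the
  -- distinct branches.
  have h : ¬ (Finset.univ.erase i).inf C.branch ≤ C.branch i := by
    intro h
    obtain ⟨j, hj, hji⟩ := (Ideal.IsPrime.inf_le' (C.isPrime_branch i)).1 h
    have hmin : C.branch i ∈ C.ideal.minimalPrimes := C.range_branch ▸ Set.mem_range_self i
    have := le_antisymm hji (hmin.2 ⟨C.isPrime_branch j, C.ideal_le_branch j⟩ hji)
    exact (Finset.mem_erase.1 hj).1 (C.branch_injective this)
  obtain ⟨f, hf, hfi⟩ := SetLike.not_le_iff_exists.1 h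
  refine ⟨Ideal.Quotient.mk _ f, fun h0 => hfi (Ideal.Quotient.eq_zero_iff_mem.1 h0),
    fun j hj => Ideal.Quotient.eq_zero_iff_mem.2 ?_⟩
  exact (Submodule.mem_finsetInf.1 hf) j (Finset.mem_erase.2 ⟨hj, Finset.mem_univ _⟩)

variable [IsAlgClosed K]

instance isDiscreteValuationRing_branchClosure (i : Fin r) :
    IsDiscreteValuationRing (C.BranchClosure i) :=
  (C.branchClosure_spec i).2.1

theorem value_apply (g : C.LocalRing) (i : Fin r) :
    C.value g i = IsDiscreteValuationRing.addVal (C.BranchClosure i)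
      (algebraMap (C.BranchRing i) (C.BranchClosure i) (C.toBranch i g)) :=
  jacobsonOrder_eq_addVal _ _

theorem value_one : C.value 1 = 0 := by
  ext1 i
  simp [value_apply]

theorem value_mul (g h : C.LocalRing) : C.value (g * h) = C.value g + C.value h := by
  ext1 i
  simp [value_apply]

theorem value_pow (g : C.LocalRing) (a : ℕ) : C.value (g ^ a) = a • C.value g := by
  induction a with
  | zero => simp [value_one]
  | succ a ih => rw [pow_succ, value_mul, ih, succ_nsmul]

theorem min_le_value_sub (g h : C.LocalRing) (i : Fin r) :
    min (C.value g i) (C.value h i) ≤ C.value (g - h) i := by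
  simp only [value_apply, map_sub]
  exact AddValuation.map_sub _ _ _

variable {C} in
theorem value_eq_top_iff {g : C.LocalRing} {i : Fin r} :
    C.value g i = ⊤ ↔ C.toBranch i g = 0 := by
  rw [value_apply, IsDiscreteValuationRing.addVal_eq_top_iff,
    map_eq_zero_iff _ (FaithfulSMul.algebraMap_injective _ _)]

theorem value_zero : C.value 0 = ⊤ := by
  ext1 i
  simp [value_eq_top_iff]

variable {C} in
theorem exists_value_ne_top {g : C.LocalRing} (hg : g ≠ 0) : ∃ i, C.value g i ≠ ⊤ := by
  by_contra! h
  exact hg (eq_zero_of_forall_toBranch_eq_zero fun i => value_eq_top_iff.1 (h i))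

theorem value_le_value_smul (c : K) (g : C.LocalRing) (i : Fin r) :
    C.value g i ≤ C.value (c • g) i := by
  simp only [value_apply, toBranch_smul, map_mul, IsDiscreteValuationRing.addVal_mul]
  exact le_add_self

theorem value_smul {c : K} (hc : c ≠ 0) (g : C.LocalRing) : C.value (c • g) = C.value g := by
  ext1 i
  refine le_antisymm ?_ (C.value_le_value_smul c g i)
  conv_rhs => rw [← inv_smul_smul₀ hc g]
  exact C.value_le_value_smul _ _ _

variable {C} in
theorem value_congr {g h : C.LocalRing} {i : Fin r} (hgh : C.toBranch i g = C.toBranch i h) :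
    C.value g i = C.value h i := by
  rw [value_apply, value_apply, hgh]

variable {C} in
theorem one_le_value {g : C.LocalRing} (hg : g ∈ IsLocalRing.maximalIdeal C.LocalRing)
    (i : Fin r) : 1 ≤ C.value g i := by
  rw [Order.one_le_iff_ne_zero, value_apply, Ne, IsDiscreteValuationRing.addVal_eq_zero_iff]
  refine (IsLocalRing.mem_maximalIdeal _).1
    ((C.branchClosure_spec i).2.2.1 _ ((IsLocalRing.mem_maximalIdeal _).2 ?_))
  have : IsLocalHom (C.toBranch i) :=
    IsLocalHom.of_surjective _ (Ideal.Quotient.factor_surjective (C.ideal_le_branch i))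
  rw [mem_nonunits_iff, isUnit_map_iff]
  exact (IsLocalRing.mem_maximalIdeal _).1 hg

-- The residue field is `K`, so the residue of the quotient of the two images is a constant `c`
-- cancelling the leading term.
variable {C} in
theorem exists_value_lt_value_sub_smul {g h : C.LocalRing} {i : Fin r}
    (hgh : C.value g i = C.value h i) (hg : C.value g i ≠ ⊤) :
    ∃ c : K, C.value g i < C.value (g - c • h) i := by
  set B := C.BranchClosure i
  set x : B := algebraMap (C.BranchRing i) B (C.toBranch i g)
  set y : B := algebraMap (C.BranchRing i) B (C.toBranch i h)
  have hx : C.value g i = IsDiscreteValuationRing.addVal B x := C.value_apply g i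
  have hy : C.value h i = IsDiscreteValuationRing.addVal B y := C.value_apply h i
  obtain ⟨u, hu⟩ := IsDiscreteValuationRing.addVal_le_iff_dvd.1 (hy.symm.trans (hgh.symm.trans hx)).le
  obtain ⟨c, hc⟩ := (C.branchClosure_spec i).2.2.2 u
  refine ⟨c, ?_⟩
  have hxy : algebraMap (C.BranchRing i) B (C.toBranch i (g - c • h)) =
      y * (u - algebraMap (C.BranchRing i) B (algebraMap K _ c)) := by
    rw [map_sub, toBranch_smul, map_sub, map_mul]
    change x - _ * y = _
    rw [hu]
    ring
  rw [C.value_apply (g - c • h), hxy, IsDiscreteValuationRing.addVal_mul, ← hy, ← hgh]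
  refine (ENat.lt_add_one_iff hg).2 le_rfl |>.trans_le (add_le_add_right ?_ _)
  rw [Order.one_le_iff_ne_zero, Ne, IsDiscreteValuationRing.addVal_eq_zero_iff]
  exact (IsLocalRing.mem_maximalIdeal _).1 hc

/-- An element whose `i`-th value is large can be replaced by one that vanishes on the `i`-th branch
and agrees with it on the other branches. -/
theorem exists_conductor (i : Fin r) : ∃ N : ℕ, ∀ g : C.LocalRing, (N : ℕ∞) ≤ C.value g i →
    ∃ g', C.value g' i = ⊤ ∧ ∀ j ≠ i, C.value g' j = C.value g j := by
  have := (C.branchClosure_spec i).1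
  obtain ⟨a, ha0, ha⟩ := exists_ne_zero_forall_exists_mul_eq_algebraMap
    (C.exists_mul_eq_algebraMap i)
  obtain ⟨w, hwi, hwj⟩ := C.exists_toBranch_ne_zero i
  obtain ⟨f, rfl⟩ := Ideal.Quotient.factor_surjective (C.ideal_le_branch i) a
  change C.toBranch i f ≠ 0 at ha0
  change ∀ b, ∃ a', algebraMap _ _ (C.toBranch i f) * b = _ at ha
  have hfw : C.value (f * w) i ≠ ⊤ := by
    rw [Ne, value_eq_top_iff, map_mul]
    exact mul_ne_zero ha0 hwi
  -- On branch `i`, `f` lies in the conductor, and `w` vanishes on the others. If `g = f w b` on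
  -- branch `i`, then `f b` comes from some `u`, and `g - u w` is the required element.
  refine ⟨(C.value (f * w) i).toNat, fun g hg => ?_⟩
  rw [ENat.natCast_toNat hfw, value_apply, value_apply,
    IsDiscreteValuationRing.addVal_le_iff_dvd] at hg
  obtain ⟨b, hb⟩ := hg
  obtain ⟨a', ha'⟩ := ha b
  obtain ⟨u, rfl⟩ := Ideal.Quotient.factor_surjective (C.ideal_le_branch i) a'
  change _ = algebraMap _ _ (C.toBranch i u) at ha'
  refine ⟨g - u * w, ?_, fun j hj => value_congr ?_⟩
  · rw [value_eq_top_iff, map_sub, sub_eq_zero]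
    apply FaithfulSMul.algebraMap_injective (C.BranchRing i) (C.BranchClosure i)
    rw [hb, map_mul, map_mul, map_mul, map_mul, ← ha']
    ring
  · rw [map_sub, map_mul, hwj j hj, mul_zero, sub_zero]

end AlgebroidCurve

/-- Strict decrease of the truncated gaps used as termination measure. -/
theorem ENat.toNat_sub_lt_toNat_sub {x y : ℕ∞} {N : ℕ} (hxy : x < y) (hx : x < N) :
    ((N : ℕ∞) - y).toNat < ((N : ℕ∞) - x).toNat := by
  lift x to ℕ using hxy.ne_top
  have hx' : x < N := by exact_mod_cast hx
  cases y with
  | top =>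
    rw [ENat.sub_top, ← ENat.natCast_sub, ENat.toNat_natCast, ENat.toNat_zero]
    omega
  | coe y =>
    have : x < y := by exact_mod_cast hxy
    rw [← ENat.natCast_sub, ← ENat.natCast_sub, ENat.toNat_natCast, ENat.toNat_natCast]
    omega

/-! ### Products, reductions and generators of the semiring. -/

namespace AlgebroidCurve

variable {K : Type*} [Field K] {n r : ℕ} {C : AlgebroidCurve K n r} {G : Set C.LocalRing}

theorem IsProduct.one : C.IsProduct G 1 := ⟨0, by simp, by simp⟩

theorem IsProduct.mul {p q : C.LocalRing} (hp : C.IsProduct G p) (hq : C.IsProduct G q) :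
    C.IsProduct G (p * q) := by
  classical
  obtain ⟨α, hα, rfl⟩ := hp
  obtain ⟨β, hβ, rfl⟩ := hq
  refine ⟨α + β, fun x hx => ?_, ?_⟩
  · rcases Finset.mem_union.1 (Finsupp.support_add hx) with h | h
    exacts [hα h, hβ h]
  · rw [Finsupp.prod_add_index' (fun _ => pow_zero _) fun _ _ _ => pow_add _ _ _]

theorem IsProduct.pow {p : C.LocalRing} (hp : C.IsProduct G p) (a : ℕ) :
    C.IsProduct G (p ^ a) := by
  induction a with
  | zero => rw [pow_zero]; exact .one
  | succ a ih => rw [pow_succ]; exact ih.mul hp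

theorem IsProduct.prod {ι : Type*} {s : Finset ι} {p : ι → C.LocalRing}
    (hp : ∀ i ∈ s, C.IsProduct G (p i)) : C.IsProduct G (∏ i ∈ s, p i) :=
  Finset.prod_induction _ _ (fun _ _ => .mul) .one hp

/-- A `G`-product is a `G \ {g}`-product or a multiple of `g`. -/
theorem IsProduct.diff_singleton_or_dvd {p : C.LocalRing} (hp : C.IsProduct G p)
    (g : C.LocalRing) : C.IsProduct (G \ {g}) p ∨ g ∣ p := by
  obtain ⟨α, hα, rfl⟩ := hp
  by_cases hg : g ∈ α.support
  · exact .inr ((dvd_pow_self g (Finsupp.mem_support_iff.1 hg)).trans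
      (Finset.dvd_prod_of_mem (fun x => x ^ α x) hg))
  · exact .inl ⟨α, fun x hx => ⟨hα hx, fun h => hg (h ▸ hx)⟩, rfl⟩

/-- Large values of an element can be made infinite without changing the other values. -/
theorem exists_value_eq_top_or_lt {N : Fin r → ℕ}
    (hN : ∀ i, ∀ g : C.LocalRing, (N i : ℕ∞) ≤ C.value g i →
      ∃ g', C.value g' i = ⊤ ∧ ∀ j ≠ i, C.value g' j = C.value g j)
    (s : Finset (Fin r)) (g : C.LocalRing) :
    ∃ g', C.value g ≤ C.value g' ∧ (∀ j ∉ s, C.value g' j = C.value g j) ∧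
      ∀ j ∈ s, C.value g' j = ⊤ ∨ C.value g' j < N j := by
  classical
  induction s using Finset.induction_on with
  | empty => exact ⟨g, le_rfl, fun _ _ => rfl, by simp⟩
  | insert k s hks ih =>
    obtain ⟨g', h1, h2, h3⟩ := ih
    by_cases hk : C.value g' k < N k
    · refine ⟨g', h1, fun j hj => h2 j fun h => hj (Finset.mem_insert_of_mem h), fun j hj => ?_⟩
      rcases Finset.mem_insert.1 hj with rfl | hj
      exacts [.inr hk, h3 j hj]
    · obtain ⟨g'', h4, h5⟩ := hN k g' (not_lt.1 hk)
      refine ⟨g'', fun j => ?_, fun j hj => ?_, fun j hj => ?_⟩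
      · rcases eq_or_ne j k with rfl | hjk
        · rw [h4]; exact le_top
        · rw [h5 j hjk]; exact h1 j
      · rw [Finset.mem_insert, not_or] at hj
        rw [h5 j hj.1, h2 j hj.2]
      · rcases eq_or_ne j k with rfl | hjk
        · exact .inl h4
        · rw [h5 j hjk]
          exact h3 j (Finset.mem_of_mem_insert_of_ne hj hjk)

variable [IsAlgClosed K]

theorem value_prod {ι : Type*} (s : Finset ι) (f : ι → C.LocalRing) :
    C.value (∏ i ∈ s, f i) = ∑ i ∈ s, C.value (f i) := by
  classical
  induction s using Finset.induction_on with
  | empty => simp [value_one]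
  | insert a s ha ih => rw [Finset.prod_insert ha, Finset.sum_insert ha, value_mul, ih]

/-- The set of values is closed under tropical monomials. -/
theorem sum_nsmul_mem_valueSet {α : (Fin r → ℕ∞) →₀ ℕ}
    (hα : (α.support : Set (Fin r → ℕ∞)) ⊆ C.valueSet) :
    (α.sum fun e a => a • e) ∈ C.valueSet := by
  have h : ∀ e, ∃ f, e ∈ α.support → C.value f = e := by
    intro e
    by_cases he : e ∈ α.support
    · obtain ⟨f, hf⟩ := hα he
      exact ⟨f, fun _ => hf⟩
    · exact ⟨0, fun h => absurd h he⟩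
  choose f hf using h
  refine ⟨α.prod fun e a => f e ^ a, ?_⟩
  rw [Finsupp.prod, value_prod]
  exact Finset.sum_congr rfl fun e he => by rw [value_pow, hf e he]

/-- Nonunits have positive value on every branch, so `f` is a unit. -/
theorem value_eq_zero_of_apply_eq_zero {f : C.LocalRing} {k : Fin r} (hf : C.value f k = 0) :
    C.value f = 0 := by
  have hu : IsUnit f := by
    by_contra h
    have := one_le_value ((IsLocalRing.mem_maximalIdeal f).2 h) k
    rw [hf] at this
    exact absurd this (by simp)
  obtain ⟨f', hf'⟩ := hu.exists_right_inv
  have h := C.value_mul f f'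
  rw [hf', value_one] at h
  ext1 i
  have hi := congrFun h i
  simp only [Pi.zero_apply, Pi.add_apply] at hi
  exact (add_eq_zero.1 hi.symm).1

/-- Where subtracting `c • p` raises the value of `g`, the leading terms cancel. Thus a reduction is
visible on values alone; `IsProduct.exists_isReduction` is the converse. -/
theorem IsReduction.exists_isProduct {g h : C.LocalRing} (hgh : C.IsReduction G g h) :
    C.value g ≤ C.value h ∧ (∃ k, C.value g k ≠ ⊤ ∧ C.value g k < C.value h k) ∧
      ∃ p, C.IsProduct G p ∧ C.value g ≤ C.value p ∧
        ∀ i, C.value g i < C.value h i → C.value p i = C.value g i := by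
  obtain ⟨k, hk, c, p, hp, rfl, hle, hlt⟩ := hgh
  have hc : c ≠ 0 := by
    rintro rfl
    rw [zero_smul, sub_zero] at hlt
    exact lt_irrefl _ hlt
  have hgp : ∀ i, C.value g i ≤ C.value p i := by
    intro i
    rw [← value_smul C hc p]
    have := C.min_le_value_sub g (g - c • p) i
    rw [sub_sub_cancel, min_eq_left (hle i)] at this
    exact this
  refine ⟨hle, ⟨k, hk, hlt⟩, p, hp, hgp,
    fun i hi => le_antisymm (not_lt.1 fun hlt' => ?_) (hgp i)⟩
  have := C.min_le_value_sub (g - c • p) ((-c) • p) i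
  rw [neg_smul, sub_neg_eq_add, sub_add_cancel, ← neg_smul, value_smul C (neg_ne_zero.2 hc)] at this
  exact absurd (lt_min hi hlt') (not_lt.2 this)

theorem IsProduct.exists_isReduction {g p : C.LocalRing} (hp : C.IsProduct G p)
    (hgp : C.value g ≤ C.value p) {k : Fin r} (hk : C.value g k ≠ ⊤)
    (hpk : C.value p k = C.value g k) : ∃ h, C.IsReduction G g h := by
  obtain ⟨c, hc⟩ := exists_value_lt_value_sub_smul hpk.symm hk
  refine ⟨_, k, hk, c, p, hp, rfl, fun i => ?_, hc⟩
  refine le_trans (le_min le_rfl ?_) (C.min_le_value_sub g (c • p) i)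
  exact (hgp i).trans (C.value_le_value_smul c p i)

theorem IsStandardBasis.exists_isProduct_of_ne_top (hG : C.IsStandardBasis G) {g : C.LocalRing}
    {i : Fin r} (hi : C.value g i ≠ ⊤) :
    ∃ p, C.IsProduct G p ∧ C.value g ≤ C.value p ∧ C.value p i = C.value g i := by
  classical
  choose N hN using C.exists_conductor
  -- Induct on the total gap below the conductor bounds, leaving out branch `i`, whose value is kept
  -- fixed.
  let μ : C.LocalRing → ℕ := fun g => ∑ j ∈ Finset.univ.erase i, ((N j : ℕ∞) - C.value g j).toNat
  have hmono : ∀ (x y : C.LocalRing) (j), C.value x ≤ C.value y →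
      ((N j : ℕ∞) - C.value y j).toNat ≤ ((N j : ℕ∞) - C.value x j).toNat := fun x y j h =>
    ENat.toNat_le_toNat (tsub_le_tsub_left (h j) _) (ne_top_of_le_ne_top (ENat.natCast_ne_top _)
      tsub_le_self)
  induction hm : μ g using Nat.strong_induction_on generalizing g with
  | _ m ih =>
    obtain ⟨g', h1, h2, h3⟩ := exists_value_eq_top_or_lt hN (Finset.univ.erase i) g
    have hi' : C.value g' i = C.value g i := h2 i (Finset.notMem_erase _ _)
    have hg' : g' ≠ 0 := by
      rintro rfl
      rw [value_zero] at hi'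
      exact hi hi'.symm
    obtain ⟨h, hh⟩ := hG.exists_reduction g' hg'
    obtain ⟨hle, ⟨k, hk, hlt⟩, p, hp, hpg, hp'⟩ := hh.exists_isProduct
    by_cases hpi : C.value p i = C.value g' i
    · exact ⟨p, hp, h1.trans hpg, hpi.trans hi'⟩
    have hki : k ≠ i := by
      rintro rfl
      exact hpi (hp' k hlt)
    have hhi : C.value h i = C.value g i :=
      (le_antisymm (not_lt.1 fun hlt' => hpi (hp' i hlt')) (hle i)).trans hi'
    -- The finite value `v_k(g')` is below `N k` after the replacement, so raising it lowers the
    -- measure strictly.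
    have hμ : μ h < m := by
      rw [← hm]
      refine lt_of_lt_of_le (Finset.sum_lt_sum (fun j _ => hmono g' h j hle)
        ⟨k, Finset.mem_erase.2 ⟨hki, Finset.mem_univ _⟩, ?_⟩)
        (Finset.sum_le_sum fun j _ => hmono g g' j h1)
      exact ENat.toNat_sub_lt_toNat_sub hlt
        ((h3 k (Finset.mem_erase.2 ⟨hki, Finset.mem_univ _⟩)).resolve_left hk)
    obtain ⟨q, hq, hhq, hqi⟩ := ih _ hμ (hhi ▸ hi) rfl
    exact ⟨q, hq, h1.trans (hle.trans hhq), hqi.trans hhi⟩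

/-- If there are at least two branches, then every value is matched at any given branch by a product
of elements of a Standard Basis whose other values are at least as large. -/
theorem IsStandardBasis.exists_isProduct (hr : 2 ≤ r) (hG : C.IsStandardBasis G) (g : C.LocalRing)
    (i : Fin r) :
    ∃ p, C.IsProduct G p ∧ C.value g ≤ C.value p ∧ C.value p i = C.value g i := by
  rcases ne_or_eq (C.value g i) ⊤ with hi | hi
  · exact hG.exists_isProduct_of_ne_top hi
  -- For an infinite value, multiply two products whose values are infinite away from two different
  -- branches: the result has value `∞` everywhere.
  have key : ∀ k, ∃ p, C.IsProduct G p ∧ ∀ j ≠ k, C.value p j = ⊤ := by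
    intro k
    obtain ⟨w, hwk, hw⟩ := C.exists_toBranch_ne_zero k
    obtain ⟨p, hp, hwp, -⟩ := hG.exists_isProduct_of_ne_top (value_eq_top_iff.not.2 hwk)
    exact ⟨p, hp, fun j hj => top_le_iff.1 ((value_eq_top_iff.2 (hw j hj)).symm.le.trans (hwp j))⟩
  obtain ⟨p, hp, hp'⟩ := key ⟨0, by omega⟩
  obtain ⟨q, hq, hq'⟩ := key ⟨1, by omega⟩
  have htop : C.value (p * q) = ⊤ := by
    ext1 j
    rw [value_mul, Pi.add_apply, Pi.top_apply]
    by_cases hj : j = ⟨0, by omega⟩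
    · rw [hq' j (by rw [hj]; simp), add_top]
    · rw [hp' j hj, top_add]
  exact ⟨p * q, hp.mul hq, htop ▸ le_top, by rw [htop, hi]; rfl⟩

theorem IsProduct.exists_value_eq_sum {p : C.LocalRing} (hp : C.IsProduct G p) :
    ∃ α : (Fin r → ℕ∞) →₀ ℕ, (α.support : Set (Fin r → ℕ∞)) ⊆ C.value '' G ∧
      C.value p = α.sum fun e a => a • e := by
  classical
  obtain ⟨α, hα, rfl⟩ := hp
  refine ⟨α.mapDomain C.value, fun e he => ?_, ?_⟩
  · obtain ⟨x, hx, rfl⟩ := Finset.mem_image.1 (Finsupp.mapDomain_support he)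
    exact ⟨x, hα hx, rfl⟩
  · rw [Finsupp.sum_mapDomain_index (h := fun e a => a • e) (fun _ => zero_smul _ _)
      (fun _ _ _ => add_smul _ _ _), Finsupp.prod, value_prod]
    exact Finset.sum_congr rfl fun x _ => value_pow C x _

/-- Take `s = r`: the `i`-th product attains the minimum in coordinate `i`. -/
theorem IsStandardBasis.generates (hr : 2 ≤ r) (hG : C.IsStandardBasis G) :
    C.Generates (C.value '' G) := by
  refine ⟨Set.image_subset_range _ _, ?_⟩
  rintro _ ⟨g, rfl⟩
  choose p hp hgp hpi using hG.exists_isProduct hr g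
  choose α hα hpα using fun i => (hp i).exists_value_eq_sum
  refine ⟨r, by omega, le_rfl, α, hα, ?_⟩
  simp only [← hpα]
  refine le_antisymm (le_iInf hgp) fun i => ?_
  rw [iInf_apply, ← hpi i]
  exact iInf_le (fun j => C.value (p j) i) i

/-- The values of a minimal Standard Basis belong to every system of generators. -/
theorem IsMinimalStandardBasis.image_value_subset (hr : 2 ≤ r) (hG : C.IsMinimalStandardBasis G)
    {E : Set (Fin r → ℕ∞)} (hE : C.Generates E) : C.value '' G ⊆ E := by
  classical
  rintro _ ⟨g, hg, rfl⟩
  obtain ⟨k, hk⟩ := exists_value_ne_top (hG.ne_zero g hg)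
  obtain ⟨s, hs, -, α, hα, hgα⟩ := hE.2 (C.value g) ⟨g, rfl⟩
  have : Nonempty (Fin s) := ⟨⟨0, hs⟩⟩
  -- Select the monomial attaining the minimum at `k`.
  obtain ⟨i, hi⟩ := exists_eq_ciInf_of_finite (f := fun i => ((α i).sum fun e a => a • e) k)
  rw [← iInf_apply, ← hgα] at hi
  replace hgα : C.value g ≤ (α i).sum fun e a => a • e := hgα.le.trans (iInf_le _ i)
  replace hα := hα i
  generalize α i = β at hi hgα hα
  have hβ : (β.support : Set (Fin r → ℕ∞)) ⊆ C.valueSet := hα.trans hE.1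
  have h : ∀ e, ∃ p, e ∈ β.support → C.IsProduct G p ∧ e ≤ C.value p ∧ C.value p k = e k := by
    intro e
    by_cases he : e ∈ β.support
    · obtain ⟨f, rfl⟩ := hβ he
      obtain ⟨p, hp⟩ := hG.exists_isProduct hr f k
      exact ⟨p, fun _ => hp⟩
    · exact ⟨0, fun h => absurd h he⟩
  choose p hp using h
  have hq : C.value (β.prod fun e a => p e ^ a) = β.sum fun e a => a • C.value (p e) := by
    rw [Finsupp.prod, value_prod]
    exact Finset.sum_congr rfl fun e _ => value_pow C _ _
  -- Otherwise every `p e` is a `G \ {g}`-product, and their monomial reduces `g` at `k`.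
  obtain ⟨e, he, u, hu⟩ : ∃ e ∈ β.support, g ∣ p e := by
    by_contra! hdvd
    refine hG.not_exists_reduction g hg (IsProduct.exists_isReduction
      (p := β.prod fun e a => p e ^ a) (IsProduct.prod fun e he =>
        IsProduct.pow (((hp e he).1.diff_singleton_or_dvd g).resolve_right (hdvd e he)) _)
      ?_ hk ?_)
    · rw [hq]
      exact hgα.trans (Finset.sum_le_sum fun e he => nsmul_le_nsmul_right (hp e he).2.1 _)
    · rw [hq, ← hi, Finsupp.sum, Finsupp.sum, Finset.sum_apply, Finset.sum_apply]
      exact Finset.sum_congr rfl fun e he => by rw [Pi.smul_apply, Pi.smul_apply, (hp e he).2.2]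
  -- Split off one copy of `e`; the remaining monomial is the value of some `f`, so cancelling at
  -- `k` makes both `u` and `f` have value zero.
  have hsplit : (β.sum fun e a => a • e) = e + (β - Finsupp.single e 1).sum fun e a => a • e := by
    have hle : Finsupp.single e 1 ≤ β := by
      rw [Finsupp.single_le_iff]
      exact Nat.one_le_iff_ne_zero.2 (Finsupp.mem_support_iff.1 he)
    conv_lhs => rw [← add_tsub_cancel_of_le hle]
    rw [Finsupp.sum_add_index' (h := fun e a => a • e) (fun _ => zero_smul _ _)
      (fun _ _ _ => add_smul _ _ _), Finsupp.sum_single_index (h := fun e a => a • e) (zero_smul _ _), one_smul]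
  obtain ⟨f, hf⟩ := sum_nsmul_mem_valueSet (C := C) (α := β - Finsupp.single e 1)
    fun x hx => hβ (Finsupp.support_tsub hx)
  rw [← hf] at hsplit
  obtain ⟨-, hep, hpe⟩ := hp e he
  rw [hu, value_mul] at hep hpe
  have hsum : C.value g k + (C.value u k + C.value f k) = C.value g k + 0 := by
    rw [← add_assoc, add_zero]
    conv_rhs => rw [← hi, hsplit, Pi.add_apply, ← hpe, Pi.add_apply]
  obtain ⟨hu0, hf0⟩ := add_eq_zero.1 (ENat.add_right_injective_of_ne_top hk hsum)
  rw [value_eq_zero_of_apply_eq_zero hu0, add_zero] at hep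
  rw [hsplit, value_eq_zero_of_apply_eq_zero hf0, add_zero] at hgα
  exact le_antisymm hgα hep ▸ hα he

end AlgebroidCurve

theorem proposition15 {K : Type*} [Field K] [IsAlgClosed K] {n r : ℕ} (hr : 2 ≤ r)
    (C : AlgebroidCurve K n r) :
    (∀ G H : Set C.LocalRing, C.IsStandardBasis G → C.IsMinimalStandardBasis H →
      C.value '' H ⊆ C.value '' G) ∧
    (∀ G H : Set C.LocalRing, C.IsMinimalStandardBasis G → C.IsMinimalStandardBasis H →
      C.value '' G = C.value '' H) ∧
    (∀ G : Set C.LocalRing, C.IsMinimalStandardBasis G →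
      IsLeast {E | C.Generates E} (C.value '' G) ∧
      ∀ E : Set (Fin r → ℕ∞), Minimal C.Generates E ↔ E = C.value '' G) := by
  have hsub : ∀ G H : Set C.LocalRing, C.IsStandardBasis G → C.IsMinimalStandardBasis H →
      C.value '' H ⊆ C.value '' G := fun G H hG hH => hH.image_value_subset hr (hG.generates hr)
  refine ⟨hsub, fun G H hG hH => (hsub H G hH.toIsStandardBasis hG).antisymm
    (hsub G H hG.toIsStandardBasis hH), fun G hG => ?_⟩
  have hleast : IsLeast {E | C.Generates E} (C.value '' G) :=
    ⟨hG.generates hr, fun E hE => hG.image_value_subset hr hE⟩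
  refine ⟨hleast, fun E => ⟨fun hE => ?_, ?_⟩⟩
  · exact (hE.2 hleast.1 (hleast.2 hE.1)).antisymm (hleast.2 hE.1)
  · rintro rfl
    exact ⟨hleast.1, fun E hE _ => hleast.2 hE⟩
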